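/- Let $\Sigma$ be an alphabet. A \emph{regular graph pattern} (RGP) over $\Sigma$ is a pair $P=(D_P,E_P)$, where $D_P$ is a finite digraph (loops allowed, at most one arc for each ordered pair of vertices) and $E_P$ assigns to each arc of $D_P$ a regular expression over $\Sigma$. For a directed walk $W$ in $P$, let $E_P(W)$ be the concatenation of the labels of its arcs (the empty-word expression if $W$ has no arc), and for a regular expression $X$ let $L(X)$ be its language and $X^+:=X\cdot X^*$. A \emph{navigational homomorphism} of an RGP $P$ to an RGP $Q$ is a map $f:V(D_P)\to V(D_Q)$ such that for each arc $(x,y)$ of $D_P$ there is a directed walk $W$ in $Q$ from $f(x)$ to $f(y)$ with $L(E_Q(W))\subseteq L(E_P(x,y))$. Let $a\in\Sigma$, and let $Q$ be a fixed RGP over $\Sigma$ whose underlying digraph is a directed path, that is, it has distinct vertices $q_0,\dots,q_n$ (for some $n\ge 0$) and exactly the arcs $(q_i,q_{i+1})$, $0\le i<n$, and all of whose arcs are labelled "$a$". Then the following decision problem can be solved in polynomial time (on a deterministic multi-stack Turing machine, in the length of the input, where an instance is given by its adjacency matrix with entries "no arc", "$a$", "$a^+$"): given an RGP $P$ over $\Sigma$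 all of whose arc labels are in $\{a,a^+\}$, does $P$ admit a navigational homomorphism to $Q$? -/

import Mathlib

/-- A regular graph pattern (RGP) over the alphabet `α` with vertex set `V`: a digraph (loops are
allowed, at most one arc per ordered pair) whose arcs carry regular expressions over `α`.
`label x y = none` means that `(x, y)` is not an arc; `label x y = some E` means that `(x, y)` is
an arc with label `E`. -/
structure RGP (α : Type*) (V : Type*) where
  label : V → V → Option (RegularExpression α)

namespace RGP

/-- The underlying digraph of an RGP. -/
def digraph {α V : Type*} (P : RGP α V) : Digraph V where
  Adj x y := ∃ E, P.label x y = some E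

/-- Directed walks from one vertex to another, as sequences of consecutive arcs. -/
inductive Walk {α V : Type*} (P : RGP α V) : V → V → Type _
  | nil (x : V) : Walk P x x
  | cons {x y z : V} (E : RegularExpression α) (h : P.label x y = some E) (w : Walk P y z) :
      Walk P x z

/-- The label of a directed walk: the concatenation of the labels of its arcs. -/
def Walk.label {α V : Type*} {P : RGP α V} {x y : V} : P.Walk x y → RegularExpression α
  | .nil _ => 1
  | .cons E _ w => E * w.label

/-- `f` is a navigational homomorphism from `P` to `Q`. -/
def IsNHom {α V W : Type*} (P : RGP α V) (Q : RGP α W) (f : V → W) : Prop :=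
  ∀ (x y : V) (E : RegularExpression α), P.label x y = some E →
    ∃ w : Q.Walk (f x) (f y), w.label.matches' ≤ E.matches'

/-- `P` admits a navigational homomorphism to `Q`. -/
def HasNHom {α V W : Type*} (P : RGP α V) (Q : RGP α W) : Prop :=
  ∃ f : V → W, IsNHom P Q f

end RGP

/-- The digraph `D` is a directed path `q₀ → q₁ → ⋯ → qₙ` (on `n + 1 ≥ 1` distinct vertices, with
no other arcs). -/
def IsDirectedPath {V : Type*} (D : Digraph V) : Prop :=
  ∃ (n : ℕ) (q : Fin (n + 1) ≃ V), ∀ i j, D.Adj (q i) (q j) ↔ (j : ℕ) = (i : ℕ) + 1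

/-- The regular expression `a⁺ = a · a*`. -/
def plusExpr {α : Type*} (a : α) : RegularExpression α :=
  RegularExpression.char a * RegularExpression.star (RegularExpression.char a)

/-- Finite RGPs, on a vertex set `{0, …, m - 1}`, whose arc labels are in `{a, a⁺}`. -/
structure APlusInstance {α : Type} (a : α) where
  m : ℕ
  pattern : RGP α (Fin m)
  label_mem : ∀ (x y : Fin m) (E : RegularExpression α), pattern.label x y = some E →
    E = RegularExpression.char a ∨ E = plusExpr a

/-- The input alphabet: the three possible entries of the labelled adjacency matrix, and an
end-of-row marker. -/
inductive ArcSymbol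
  | noArc
  | arcA
  | arcAPlus
  | endRow
  deriving DecidableEq

instance : Fintype ArcSymbol where
  elems := {.noArc, .arcA, .arcAPlus, .endRow}
  complete := by rintro (_ | _ | _ | _) <;> decide

open Classical in
/-- The adjacency matrix entry of an ordered pair: no arc, an arc labelled `a`, or an arc
labelled `a⁺` (the only other possibility in an `APlusInstance`). -/
noncomputable def arcSymbol {α : Type} (a : α) : Option (RegularExpression α) → ArcSymbol
  | none => .noArc
  | some E => if E = RegularExpression.char a then .arcA else .arcAPlus

namespace APlusInstance

/-- The row of the labelled adjacency matrix that belongs to the vertex `x`. -/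
noncomputable def encodeRow {α : Type} {a : α} (P : APlusInstance a) (x : Fin P.m) :
    List ArcSymbol :=
  List.ofFn (fun y : Fin P.m => arcSymbol a (P.pattern.label x y)) ++ [ArcSymbol.endRow]

/-- The encoding of an instance: its labelled adjacency matrix, row by row. -/
noncomputable def encode {α : Type} {a : α} (P : APlusInstance a) : List ArcSymbol :=
  (List.ofFn P.encodeRow).flatten

theorem length_encodeRow {α : Type} {a : α} (P : APlusInstance a) (x : Fin P.m) :
    (P.encodeRow x).length = P.m + 1 := by
  simp [encodeRow]

theorem length_encode {α : Type} {a : α} (P : APlusInstance a) :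
    P.encode.length = P.m * (P.m + 1) := by
  simp [encode, List.length_flatten, List.map_ofFn, Function.comp_def, length_encodeRow]

theorem flatten_inj_of_length {β : Type} (k : ℕ) : ∀ L L' : List (List β),
    (∀ l ∈ L, l.length = k + 1) → (∀ l ∈ L', l.length = k + 1) → L.flatten = L'.flatten → L = L'
  | [], [], _, _, _ => rfl
  | [], l :: L', _, h', h => by
      have h1 := h' l (by simp)
      have h2 := congrArg List.length h
      simp only [List.flatten_nil, List.flatten_cons, List.length_append, List.length_nil] at h2
      omega
  | l :: L, [], h', _, h => by
      have h1 := h' l (by simp)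
      have h2 := congrArg List.length h
      simp only [List.flatten_nil, List.flatten_cons, List.length_append, List.length_nil] at h2
      omega
  | l :: L, l' :: L', h1, h2, h => by
      have h3 := List.append_inj (by simpa using h)
        ((h1 l (by simp)).trans (h2 l' (by simp)).symm)
      rw [h3.1, flatten_inj_of_length k L L' (fun x hx => h1 x (by simp [hx]))
        (fun x hx => h2 x (by simp [hx])) h3.2]

theorem char_ne_plusExpr {α : Type} (a : α) : RegularExpression.char a ≠ plusExpr a := by
  intro h
  cases h

/-- Distinct instances have distinct encodings. -/
theorem encode_injective {α : Type} {a : α} :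
    Function.Injective (encode : APlusInstance a → List ArcSymbol) := by
  rintro ⟨m, ⟨P⟩, hP⟩ ⟨m', ⟨P'⟩, hP'⟩ h
  have hm : m = m' := by
    have h1 := congrArg List.length h
    rw [length_encode, length_encode] at h1
    simp only at h1
    nlinarith [lt_trichotomy m m', h1]
  subst hm
  have h1 := flatten_inj_of_length m _ _ (by simp [encodeRow]) (by simp [encodeRow]) h
  have h2 := List.ofFn_injective h1
  have h3 : P = P' := by
    funext x y
    have h4 := congrFun h2 x
    simp only [encodeRow, List.append_cancel_right_eq] at h4
    have h5 := congrFun (List.ofFn_injective h4) y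
    have h6 := hP x y
    have h7 := hP' x y
    simp only at h5 h6 h7
    have hne := char_ne_plusExpr a
    rcases hE : P x y with _ | E <;> rcases hE' : P' x y with _ | E' <;>
      simp only [hE, hE', arcSymbol] at h5 h6 h7
    · rfl
    · split_ifs at h5
    · split_ifs at h5
    · rcases h6 E rfl with rfl | rfl <;> rcases h7 E' rfl with rfl | rfl <;>
        simp_all [hne.symm]
  subst h3
  rfl

end APlusInstance

/-- The decision problem `p`, whose instances are presented through the encoding `enc`, is
solvable in polynomial time: some multi-stack Turing machine, with finitely many stacks, labels,
internal states and stack symbols, started on `enc x`, halts with the answer `p x` on its output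
stack after a number of steps that is bounded by a polynomial in the length of `enc x`. -/
def SolvableInPolyTime {ι Γ : Type} (enc : ι → List Γ) (p : ι → Prop) : Prop :=
  ∃ f : ι → Bool, (∀ x, f x = true ↔ p x) ∧
    ∃ M : Turing.TM2ComputableInPolyTime enc Computability.encodeBool f,
      ∀ k : M.tm.K, Finite (M.tm.Γ k)

/-! A walk of `k` arcs on the path has language `{a ^ k}`, and `k` is the difference of the
positions of its ends. A homomorphism is therefore a map of the vertices to positions in `{0, …, n}`
with `y = x + 1` across each arc labelled `a` and `x + 1 ≤ y` across each arc labelled `a⁺`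
(`RGP.exists_walk_le_iff`, `APlusInstance.hasNHom_iff`).

Such difference constraints are solved by propagating lower bounds. All bounds start at `0`, and an
entry of the matrix raises a bound only when the constraint forces it, so the bounds stay below
every solution (`Relax.round_below`). They are truncated at `n + 1`: a bound with this value
excludes every solution on the path. If a round changes nothing and all bounds are at most `n`, the
bounds themselves are a solution (`Relax.round_fixed`). A round with a change increases the sum of
the `m` bounds (`Relax.weight_lt_round`), so there are at most `m * (n + 1) + 1` rounds.

A round is one sweep of the matrix, which a stack machine performs in `O(m ^ 2)` steps. As `n` is
fixed, the total is quadratic in the input length `m * (m + 1)`. -/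

/-- The constraint that an adjacency matrix entry imposes on the positions of the two end
vertices on a directed path. -/
def ArcSymbol.Admits (s : ArcSymbol) (x y : ℕ) : Prop :=
  match s with
  | .arcA => y = x + 1
  | .arcAPlus => x + 1 ≤ y
  | _ => True

/-! ### Languages of walks on a directed path -/

theorem RegularExpression.matches'_mul_of_singleton {α : Type*} {E F : RegularExpression α}
    {u v : List α} (hE : E.matches' = {u}) (hF : F.matches' = {v}) :
    (E * F).matches' = {u ++ v} := by
  rw [RegularExpression.matches'_mul, hE, hF, Language.mul_def]
  exact Set.image2_singleton

theorem plusExpr_matches'_iff {α : Type*} (a : α) (k : ℕ) :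
    List.replicate k a ∈ (plusExpr a).matches' ↔ 1 ≤ k := by
  rw [plusExpr, RegularExpression.matches'_mul]
  constructor
  · rintro ⟨u, hu, v, -, h⟩
    have hu : u = [a] := hu
    have := congrArg List.length h
    simp [hu] at this
    omega
  · intro hk
    refine ⟨[a], rfl, List.replicate (k - 1) a, ?_, ?_⟩
    · change _ ∈ KStar.kstar (RegularExpression.char a).matches'
      rw [Language.mem_kstar]
      refine ⟨List.replicate (k - 1) [a], ?_, ?_⟩
      · generalize k - 1 = j
        induction j with
        | zero => rfl
        | succ j ih => simp [List.replicate_succ, ← ih]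
      · intro y hy
        rw [List.eq_of_mem_replicate hy]
        rfl
    · obtain ⟨j, rfl⟩ := Nat.exists_eq_add_of_le hk
      simp [Nat.add_comm 1 j, List.replicate_succ]

namespace RGP

variable {α V : Type*} {Q : RGP α V} {a : α} {n : ℕ} {q : Fin (n + 1) ≃ V}

theorem Walk.exists_matches' (hq : ∀ i j, Q.digraph.Adj (q i) (q j) ↔ (j : ℕ) = (i : ℕ) + 1)
    (hlabel : ∀ x y E, Q.label x y = some E → E = RegularExpression.char a)
    {x y : V} (w : Q.Walk x y) :
    ∃ k, (q.symm y : ℕ) = q.symm x + k ∧ w.label.matches' = {List.replicate k a} := by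
  induction w with
  | nil x => exact ⟨0, by simp, rfl⟩
  | @cons x y z E h w ih =>
    obtain ⟨k, hk, hw⟩ := ih
    have hxy : (q.symm y : ℕ) = q.symm x + 1 := by
      rw [← hq]
      simpa using ⟨E, h⟩
    refine ⟨k + 1, by omega, ?_⟩
    have hE : E.matches' = {[a]} := by rw [hlabel _ _ _ h]; rfl
    exact RegularExpression.matches'_mul_of_singleton hE hw

theorem Walk.nonempty_of_le (hq : ∀ i j, Q.digraph.Adj (q i) (q j) ↔ (j : ℕ) = (i : ℕ) + 1)
    (k : ℕ) : ∀ i j : Fin (n + 1), (j : ℕ) = i + k → Nonempty (Q.Walk (q i) (q j)) := by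
  induction k with
  | zero =>
    intro i j h
    obtain rfl : i = j := Fin.ext h.symm
    exact ⟨.nil _⟩
  | succ k ih =>
    intro i j h
    obtain ⟨E, hE⟩ := (hq i ⟨i + 1, by omega⟩).2 rfl
    obtain ⟨w⟩ := ih ⟨i + 1, by omega⟩ j (by simp; omega)
    exact ⟨.cons E hE w⟩

open Classical in
theorem exists_walk_le_iff {α : Type} {V : Type*} {Q : RGP α V} {a : α} {n : ℕ}
    {q : Fin (n + 1) ≃ V} (hq : ∀ i j, Q.digraph.Adj (q i) (q j) ↔ (j : ℕ) = (i : ℕ) + 1)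
    (hlabel : ∀ x y E, Q.label x y = some E → E = RegularExpression.char a)
    {E : RegularExpression α} (hE : E = RegularExpression.char a ∨ E = plusExpr a) (x y : V) :
    (∃ w : Q.Walk x y, w.label.matches' ≤ E.matches') ↔
      (if E = RegularExpression.char a then (q.symm y : ℕ) = q.symm x + 1
        else (q.symm x : ℕ) + 1 ≤ q.symm y) := by
  have key : (∃ w : Q.Walk x y, w.label.matches' ≤ E.matches') ↔
      ∃ k, (q.symm y : ℕ) = q.symm x + k ∧ List.replicate k a ∈ E.matches' := by
    constructor
    · rintro ⟨w, hw⟩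
      obtain ⟨k, hk, h⟩ := w.exists_matches' hq hlabel
      exact ⟨k, hk, hw (by rw [h]; rfl)⟩
    · rintro ⟨k, hk, h⟩
      obtain ⟨w⟩ := Walk.nonempty_of_le hq k _ _ hk
      rw [q.apply_symm_apply, q.apply_symm_apply] at w
      refine ⟨w, ?_⟩
      -- The two end positions determine the length of any walk between them, so the language of
      -- this walk is exactly `{a ^ k}`.
      obtain ⟨k', hk', h'⟩ := w.exists_matches' hq hlabel
      obtain rfl : k = k' := by omega
      rw [h']
      rintro u rfl
      exact h
  rw [key]
  rcases hE with rfl | rfl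
  · rw [if_pos rfl]
    constructor
    · rintro ⟨k, hk, h⟩
      have h : List.replicate k a = [a] := h
      have := congrArg List.length h
      simp at this
      omega
    · intro h
      exact ⟨1, h, rfl⟩
  · rw [if_neg (APlusInstance.char_ne_plusExpr a).symm]
    constructor
    · rintro ⟨k, hk, h⟩
      rw [plusExpr_matches'_iff] at h
      omega
    · intro h
      exact ⟨q.symm y - q.symm x, by omega, (plusExpr_matches'_iff _ _).2 (by omega)⟩

end RGP

/-! ### Homomorphisms as solutions of difference constraints -/

theorem List.forall₂_ofFn_iff {β γ : Type*} {m : ℕ} {r : β → γ → Prop} {b : Fin m → β}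
    {c : Fin m → γ} : List.Forall₂ r (List.ofFn b) (List.ofFn c) ↔ ∀ i, r (b i) (c i) := by
  rw [List.forall₂_iff_get]
  simp only [List.length_ofFn, List.get_ofFn, true_and]
  exact ⟨fun h i => h i i.2 i.2, fun h i h1 h2 => h ⟨i, by simpa using h1⟩⟩

/-- `MatrixAdmits rows xs ys`: every entry of the matrix `rows` admits the value in `xs` of its row
and the value in `ys` of its column. -/
def MatrixAdmits (rows : List (List ArcSymbol)) (xs ys : List ℕ) : Prop :=
  List.Forall₂ (fun row x => List.Forall₂ (fun s y => ArcSymbol.Admits s x y) row ys) rows xs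

namespace APlusInstance

/-- The adjacency matrix of an instance. -/
noncomputable def rows {α : Type} {a : α} (P : APlusInstance a) : List (List ArcSymbol) :=
  List.ofFn fun x => List.ofFn fun y => arcSymbol a (P.pattern.label x y)

theorem encode_eq {α : Type} {a : α} (P : APlusInstance a) :
    P.encode = (P.rows.map (· ++ [ArcSymbol.endRow])).flatten := by
  rw [encode, rows, List.map_ofFn]
  rfl

theorem length_rows {α : Type} {a : α} (P : APlusInstance a) : P.rows.length = P.m := by
  simp [rows]

theorem length_of_mem_rows {α : Type} {a : α} (P : APlusInstance a) :
    ∀ row ∈ P.rows, row.length = P.m := by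
  simp [rows, List.mem_ofFn]

theorem endRow_notMem_of_mem_rows {α : Type} {a : α} (P : APlusInstance a) :
    ∀ row ∈ P.rows, ArcSymbol.endRow ∉ row := by
  simp only [rows, List.mem_ofFn, forall_exists_index, forall_apply_eq_imp_iff]
  rintro x ⟨y, h⟩
  rcases hE : P.pattern.label x y with _ | E <;> simp only [hE, arcSymbol] at h
  · cases h
  · split_ifs at h

theorem hasNHom_iff {α : Type} {a : α} {V : Type*} {Q : RGP α V} {n : ℕ} {q : Fin (n + 1) ≃ V}
    (hq : ∀ i j, Q.digraph.Adj (q i) (q j) ↔ (j : ℕ) = (i : ℕ) + 1)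
    (hlabel : ∀ x y E, Q.label x y = some E → E = RegularExpression.char a)
    (P : APlusInstance a) :
    P.pattern.HasNHom Q ↔ ∃ xs : List ℕ, (∀ x ∈ xs, x ≤ n) ∧ MatrixAdmits P.rows xs xs := by
  have key : ∀ f : Fin P.m → V, P.pattern.IsNHom Q f ↔
      MatrixAdmits P.rows (List.ofFn fun x => (q.symm (f x) : ℕ))
        (List.ofFn fun x => (q.symm (f x) : ℕ)) := by
    intro f
    simp only [MatrixAdmits, rows, List.forall₂_ofFn_iff, RGP.IsNHom]
    refine forall_congr' fun x => forall_congr' fun y => ?_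
    rcases hE : P.pattern.label x y with _ | E
    · simp [arcSymbol, ArcSymbol.Admits]
    · simp only [Option.some.injEq, forall_eq', arcSymbol]
      rw [RGP.exists_walk_le_iff hq hlabel (P.label_mem x y E hE)]
      split_ifs <;> rfl
  constructor
  · rintro ⟨f, hf⟩
    refine ⟨_, ?_, (key f).1 hf⟩
    simp only [List.mem_ofFn, forall_exists_index, forall_apply_eq_imp_iff]
    intro x
    exact Nat.lt_succ_iff.1 (q.symm (f x)).2
  · rintro ⟨xs, hxs, h⟩
    -- No length is prescribed for `xs`: having one entry per row of the matrix forces it.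
    have hlen : xs.length = P.m := by rw [← List.Forall₂.length_eq h, length_rows]
    refine ⟨fun x => q ⟨xs[(x : ℕ)]'(by omega), Nat.lt_succ_iff.2 (hxs _ (List.getElem_mem _))⟩,
      (key _).2 ?_⟩
    have : (List.ofFn fun x : Fin P.m => xs[(x : ℕ)]'(by omega)) = xs := by
      apply List.ext_getElem <;> simp [hlen]
    simpa [this] using h

end APlusInstance

/-! ### Relaxation of truncated lower bounds -/

namespace Relax

variable {n : ℕ}

/-- The successor, truncated at the value `n + 1`, which stands for "beyond the path". -/
def raise (r : Fin (n + 2)) : Fin (n + 2) := ⟨min (r + 1) (n + 1), by omega⟩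

/-- The truncated predecessor. -/
def lower (c : Fin (n + 2)) : Fin (n + 2) := ⟨c - 1, by omega⟩

/-- The new lower bound of the column vertex of an entry, from the bounds `r` and `c` of its row
and column vertices. -/
def col (s : ArcSymbol) (r c : Fin (n + 2)) : Fin (n + 2) :=
  match s with
  | .arcA | .arcAPlus => max c (raise r)
  | _ => c

/-- The new lower bound of the row vertex of an entry. -/
def row (s : ArcSymbol) (r c : Fin (n + 2)) : Fin (n + 2) :=
  match s with
  | .arcA => max r (lower c)
  | _ => r

/-- The bound of the row vertex, and a flag that records whether some bound has changed. -/
def cell (s : ArcSymbol) (v : Fin (n + 2) × Bool) (c : Fin (n + 2)) : Fin (n + 2) × Bool :=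
  (row s v.1 c, v.2 || decide (row s v.1 c ≠ v.1 ∨ col s v.1 c ≠ c))

/-- Relaxation along a row of the matrix. -/
def line : Fin (n + 2) × Bool → List ArcSymbol → List (Fin (n + 2)) →
    (Fin (n + 2) × Bool) × List (Fin (n + 2))
  | v, s :: ss, c :: cs =>
    ((line (cell s v c) ss cs).1, col s v.1 c :: (line (cell s v c) ss cs).2)
  | v, _, _ => (v, [])

/-- Relaxation along all rows: the new bounds of the rows, the new bounds of the columns, and
the flag. -/
def matrix : Bool → List (List ArcSymbol) → List (Fin (n + 2)) → List (Fin (n + 2)) →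
    List (Fin (n + 2)) × List (Fin (n + 2)) × Bool
  | b, l :: ls, r :: rs, cs =>
    let p := line (r, b) l cs
    let q := matrix p.1.2 ls rs p.2
    (p.1.1 :: q.1, q.2)
  | b, _, _, cs => ([], cs, b)

/-- `cs` is a list of lower bounds of `ys`. -/
def Below (cs : List (Fin (n + 2))) (ys : List ℕ) : Prop :=
  List.Forall₂ (fun (c : Fin (n + 2)) y => (c : ℕ) ≤ y) cs ys

/-- The sum of a list of bounds. -/
def weight (cs : List (Fin (n + 2))) : ℕ := (cs.map Fin.val).sum

@[simp] theorem weight_nil : weight ([] : List (Fin (n + 2))) = 0 := rfl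

@[simp] theorem weight_cons (c : Fin (n + 2)) (cs : List (Fin (n + 2))) :
    weight (c :: cs) = c + weight cs := by simp [weight]

theorem weight_le (cs : List (Fin (n + 2))) : weight cs ≤ cs.length * (n + 1) := by
  induction cs with
  | nil => simp
  | cons c cs ih =>
    simp only [weight_cons, List.length_cons, Nat.add_mul]
    omega

theorem le_col (s : ArcSymbol) (r c : Fin (n + 2)) : c ≤ col s r c := by
  cases s <;> simp [col]

theorem le_row (s : ArcSymbol) (r c : Fin (n + 2)) : r ≤ row s r c := by
  cases s <;> simp [row]

theorem col_le {s : ArcSymbol} {r c : Fin (n + 2)} {x y : ℕ} (h : s.Admits x y)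
    (hr : (r : ℕ) ≤ x) (hc : (c : ℕ) ≤ y) : (col s r c : ℕ) ≤ y := by
  cases s <;> simp only [ArcSymbol.Admits] at h <;> simp [col, raise, Fin.coe_max] <;> omega

theorem row_le {s : ArcSymbol} {r c : Fin (n + 2)} {x y : ℕ} (h : s.Admits x y)
    (hr : (r : ℕ) ≤ x) (hc : (c : ℕ) ≤ y) : (row s r c : ℕ) ≤ x := by
  cases s <;> simp only [ArcSymbol.Admits] at h <;> simp [row, lower, Fin.coe_max] <;> omega

/-- Stationarity gives `raise r ≤ c`, and for `arcA` also `c - 1 ≤ r`. The hypothesis `c ≤ n` makes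
the truncation in `raise` inactive; at `c = r = n + 1` an entry would be stationary with its
constraint violated. -/
theorem admits_of_fixed {s : ArcSymbol} {r c : Fin (n + 2)} (hrow : row s r c = r)
    (hcol : col s r c = c) (hc : (c : ℕ) ≤ n) : s.Admits r c := by
  cases s <;> simp only [row, col, max_eq_left_iff, Fin.le_def, raise, lower] at hrow hcol <;>
    simp only [ArcSymbol.Admits] <;> omega

/-- The flag enters the inequality as a number, so that it telescopes along a row and then over all
rows: a flag that turns from false to true is paid for by a growth of the bounds. -/
theorem cell_weight (s : ArcSymbol) (v : Fin (n + 2) × Bool) (c : Fin (n + 2)) :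
    (v.1 : ℕ) + c + (cell s v c).2.toNat ≤ (cell s v c).1 + col s v.1 c + v.2.toNat := by
  have h1 := le_col s v.1 c
  have h2 := le_row s v.1 c
  rcases v with ⟨r, b⟩
  simp only [cell, Fin.le_def] at h1 h2 ⊢
  by_cases h : row s r c ≠ r ∨ col s r c ≠ c
  · have h' := h
    simp only [ne_eq, Fin.ext_iff] at h'
    have := Bool.toNat_le b
    simp only [h, decide_true, Bool.or_true, Bool.toNat_true]
    omega
  · simp only [h, decide_false, Bool.or_false]
    omega

theorem length_line : ∀ (v : Fin (n + 2) × Bool) (l : List ArcSymbol) (cs : List (Fin (n + 2))),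
    l.length = cs.length → (line v l cs).2.length = cs.length
  | _, _ :: _, _ :: _, h => by simpa [line] using length_line _ _ _ (by simpa using h)
  | _, [], [], _ => rfl

theorem line_below {x : ℕ} {v : Fin (n + 2) × Bool} {l : List ArcSymbol}
    {cs : List (Fin (n + 2))} {ys : List ℕ} (hv : (v.1 : ℕ) ≤ x) (hcs : Below cs ys)
    (h : List.Forall₂ (fun s y => ArcSymbol.Admits s x y) l ys) :
    ((line v l cs).1.1 : ℕ) ≤ x ∧ Below (line v l cs).2 ys := by
  induction h generalizing v cs with
  | nil =>
    cases hcs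
    exact ⟨hv, .nil⟩
  | cons h _ ih =>
    cases hcs with
    | cons hc hcs =>
      have := ih (v := cell _ v _) (row_le h hv hc) hcs
      exact ⟨this.1, .cons (col_le h hv hc) this.2⟩

theorem line_weight : ∀ (v : Fin (n + 2) × Bool) (l : List ArcSymbol) (cs : List (Fin (n + 2))),
    l.length = cs.length →
    (v.1 : ℕ) + weight cs + (line v l cs).1.2.toNat ≤
      (line v l cs).1.1 + weight (line v l cs).2 + v.2.toNat
  | v, s :: ss, c :: cs, h => by
    have h1 := line_weight (cell s v c) ss cs (by simpa using h)
    have h2 := cell_weight s v c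
    simp only [line, weight_cons]
    omega
  | _, [], [], _ => by simp [line]

/-- The flag is never reset within a row, so a false flag at the end means that no cell changed
anything, and every entry was tested against the original bounds. -/
theorem line_fixed : ∀ (v : Fin (n + 2) × Bool) (l : List ArcSymbol) (cs : List (Fin (n + 2))),
    l.length = cs.length → (line v l cs).1.2 = false →
    v.2 = false ∧ line v l cs = (v, cs) ∧ ((∀ c ∈ cs, (c : ℕ) ≤ n) →
      List.Forall₂ (fun s y => ArcSymbol.Admits s v.1 y) l (cs.map Fin.val))
  | v, s :: ss, c :: cs, h, hf => by
    obtain ⟨h1, h2, h3⟩ := line_fixed (cell s v c) ss cs (by simpa using h) hf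
    rcases v with ⟨r, b⟩
    simp only [cell, Bool.or_eq_false_iff, decide_eq_false_iff_not, not_or, ne_eq,
      not_not] at h1
    obtain ⟨rfl, hr, hc⟩ := h1
    have hcell : cell s (r, false) c = (r, false) := by simp [cell, hr, hc]
    rw [hcell] at h2 h3
    refine ⟨rfl, by simp [line, hcell, h2, hc], fun hle => ?_⟩
    exact .cons (admits_of_fixed hr hc (hle c (by simp)))
      (h3 fun c' h' => hle c' (by simp [h']))
  | _, [], [], _, hf => ⟨hf, rfl, fun _ => .nil⟩

theorem length_matrix : ∀ (b : Bool) (ls : List (List ArcSymbol)) (rs cs : List (Fin (n + 2))),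
    ls.length = rs.length → (∀ l ∈ ls, l.length = cs.length) →
    (matrix b ls rs cs).1.length = rs.length ∧ (matrix b ls rs cs).2.1.length = cs.length
  | b, l :: ls, r :: rs, cs, h, hl => by
    have h0 := length_line (r, b) l cs (hl l (by simp))
    have := length_matrix (line (r, b) l cs).1.2 ls rs (line (r, b) l cs).2 (by simpa using h)
      (fun l' h' => by rw [h0]; exact hl l' (by simp [h']))
    simpa [matrix, h0] using this
  | _, [], [], _, _, _ => ⟨rfl, rfl⟩

theorem matrix_below {b : Bool} {ls : List (List ArcSymbol)} {rs cs : List (Fin (n + 2))}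
    {xs ys : List ℕ} (hrs : Below rs xs) (hcs : Below cs ys) (h : MatrixAdmits ls xs ys) :
    Below (matrix b ls rs cs).1 xs ∧ Below (matrix b ls rs cs).2.1 ys := by
  induction h generalizing b rs cs with
  | nil =>
    cases hrs
    exact ⟨.nil, hcs⟩
  | @cons l _ _ _ hl _ ih =>
    cases hrs with
    | @cons r _ rs _ hr hrs =>
      have h := line_below (v := (r, b)) hr hcs hl
      have := ih (b := (line (r, b) l cs).1.2) hrs h.2
      exact ⟨.cons h.1 this.1, this.2⟩

theorem matrix_weight : ∀ (b : Bool) (ls : List (List ArcSymbol)) (rs cs : List (Fin (n + 2))),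
    ls.length = rs.length → (∀ l ∈ ls, l.length = cs.length) →
    weight rs + weight cs + (matrix b ls rs cs).2.2.toNat ≤
      weight (matrix b ls rs cs).1 + weight (matrix b ls rs cs).2.1 + b.toNat
  | b, l :: ls, r :: rs, cs, h, hl => by
    have h0 := length_line (r, b) l cs (hl l (by simp))
    have h1 := line_weight (r, b) l cs (hl l (by simp))
    have h2 := matrix_weight (line (r, b) l cs).1.2 ls rs (line (r, b) l cs).2
      (by simpa using h) (fun l' h' => by rw [h0]; exact hl l' (by simp [h']))
    simp only [matrix, weight_cons] at h1 h2 ⊢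
    omega
  | _, [], [], _, _, _ => by simp [matrix]

theorem matrix_fixed : ∀ (b : Bool) (ls : List (List ArcSymbol)) (rs cs : List (Fin (n + 2))),
    ls.length = rs.length → (∀ l ∈ ls, l.length = cs.length) →
    (matrix b ls rs cs).2.2 = false →
    b = false ∧ matrix b ls rs cs = (rs, cs, false) ∧ ((∀ c ∈ cs, (c : ℕ) ≤ n) →
      MatrixAdmits ls (rs.map Fin.val) (cs.map Fin.val))
  | b, l :: ls, r :: rs, cs, h, hl, hf => by
    have h0 := length_line (r, b) l cs (hl l (by simp))
    obtain ⟨h1, h2, h3⟩ := matrix_fixed (line (r, b) l cs).1.2 ls rs (line (r, b) l cs).2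
      (by simpa using h) (fun l' h' => by rw [h0]; exact hl l' (by simp [h'])) hf
    obtain ⟨h4, h5, h6⟩ := line_fixed (r, b) l cs (hl l (by simp)) h1
    simp only at h4
    subst h4
    simp only [h5] at h2 h3
    exact ⟨rfl, by simp [matrix, h5, h2], fun hle => .cons (h6 hle) (h3 hle)⟩
  | _, [], [], _, _, _, hf => by
    obtain rfl : _ = false := hf
    exact ⟨rfl, rfl, fun _ => .nil⟩

/-- Row and column bounds are raised separately during a round. The factor `2` accounts for both
copies starting from the same list, so a growth of either copy survives the merge. -/
theorem weight_zipWith_max : ∀ rs cs : List (Fin (n + 2)), rs.length = cs.length →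
    weight rs + weight cs ≤ 2 * weight (List.zipWith max rs cs)
  | r :: rs, c :: cs, h => by
    have := weight_zipWith_max rs cs (by simpa using h)
    simp only [weight_cons, List.zipWith_cons_cons, Fin.coe_max]
    omega
  | [], [], _ => by simp

theorem zipWith_max_below : ∀ (rs cs : List (Fin (n + 2))) (xs : List ℕ), Below rs xs →
    Below cs xs → Below (List.zipWith max rs cs) xs
  | _, _, _, .cons hr hrs, .cons hc hcs =>
    .cons (by rw [Fin.coe_max]; exact max_le hr hc) (zipWith_max_below _ _ _ hrs hcs)
  | _, _, _, .nil, .nil => .nil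

/-- One round of relaxation: the new bounds of the vertices. -/
def round (ls : List (List ArcSymbol)) (g : List (Fin (n + 2))) : List (Fin (n + 2)) :=
  List.zipWith max (matrix false ls g g).1 (matrix false ls g g).2.1

/-- Whether a round of relaxation changes a bound. -/
def changes (ls : List (List ArcSymbol)) (g : List (Fin (n + 2))) : Bool :=
  (matrix false ls g g).2.2

variable {ls : List (List ArcSymbol)} {g : List (Fin (n + 2))}

theorem length_round (h : ls.length = g.length) (hl : ∀ l ∈ ls, l.length = g.length) :
    (round ls g).length = g.length := by
  simp [round, length_matrix false ls g g h hl]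

theorem round_below {xs : List ℕ} (hg : Below g xs) (hls : MatrixAdmits ls xs xs) :
    Below (round ls g) xs :=
  have h := matrix_below (b := false) hg hg hls
  zipWith_max_below _ _ _ h.1 h.2

theorem weight_lt_round (h : ls.length = g.length) (hl : ∀ l ∈ ls, l.length = g.length)
    (hc : changes ls g = true) : weight g < weight (round ls g) := by
  have h1 := matrix_weight false ls g g h hl
  have h2 := length_matrix false ls g g h hl
  have h3 := weight_zipWith_max _ _ (h2.1.trans h2.2.symm)
  rw [changes] at hc
  simp only [hc, Bool.toNat_true, Bool.toNat_false] at h1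
  rw [round]
  omega

theorem round_fixed (h : ls.length = g.length) (hl : ∀ l ∈ ls, l.length = g.length)
    (hc : changes ls g = false) : round ls g = g ∧ ((∀ c ∈ g, (c : ℕ) ≤ n) →
      MatrixAdmits ls (g.map Fin.val) (g.map Fin.val)) := by
  obtain ⟨-, h1, h2⟩ := matrix_fixed false ls g g h hl hc
  exact ⟨by simp [round, h1], h2⟩

end Relax


/-! ### Reachability with a bound on the number of steps -/

/-- `c` reaches `d` in at most `k` steps. -/
def StateTransition.ReachesWithin {σ : Type*} (f : σ → Option σ) (k : ℕ) (c d : σ) : Prop :=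
  ∃ j ≤ k, (flip bind f)^[j] (some c) = some d

namespace StateTransition.ReachesWithin

variable {σ : Type*} {f : σ → Option σ} {k l : ℕ} {c d e : σ}

theorem refl (c : σ) : ReachesWithin f 0 c c := ⟨0, le_rfl, rfl⟩

theorem trans (h : ReachesWithin f k c d) (h' : ReachesWithin f l d e) :
    ReachesWithin f (k + l) c e := by
  obtain ⟨i, hi, h⟩ := h
  obtain ⟨j, hj, h'⟩ := h'
  refine ⟨j + i, by omega, ?_⟩
  rw [Function.iterate_add_apply, h, h']

theorem single (h : f c = some d) : ReachesWithin f 1 c d := ⟨1, le_rfl, h⟩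

theorem head (h : f c = some d) (h' : ReachesWithin f k d e) : ReachesWithin f (k + 1) c e :=
  Nat.add_comm 1 k ▸ (single h).trans h'

theorem mono (h : ReachesWithin f k c d) (hkl : k ≤ l) : ReachesWithin f l c d := by
  obtain ⟨i, hi, h⟩ := h
  exact ⟨i, hi.trans hkl, h⟩

end StateTransition.ReachesWithin

/-! ### The stack machine -/

namespace Relax.Machine

open Turing StateTransition

/-- The stacks: the matrix (`A` unread, `B` read), the bounds of the columns (`C` unread, `C'`
read), the bounds of the rows (`R` unread, `R'` read), and the output `O`. -/
inductive Stack
  | A | B | C | C' | R | R' | O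
  deriving DecidableEq

instance : Fintype Stack where
  elems := {.A, .B, .C, .C', .R, .R', .O}
  complete := by rintro (_ | _ | _ | _ | _ | _ | _) <;> decide

/-- The stack alphabets. -/
abbrev Sym (n : ℕ) : Stack → Type
  | .A | .B => ArcSymbol
  | .O => Bool
  | _ => Fin (n + 2)

inductive Label
  | init | flush | head | cells | back | rev | merge | drainA | drainC
  deriving DecidableEq

instance : Fintype Label where
  elems := {.init, .flush, .head, .cells, .back, .rev, .merge, .drainA, .drainC}
  complete := by rintro (_ | _ | _ | _ | _ | _ | _ | _ | _) <;> decide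

/-- The internal state: the bound of the current row, a flag, and the last symbols read. -/
structure State (n : ℕ) where
  val : Fin (n + 2)
  flag : Bool
  sym : Option ArcSymbol
  bound : Option (Fin (n + 2))
  deriving DecidableEq, Fintype

variable {n : ℕ}

/-- Forget the last symbols read. -/
def State.clear (v : State n) : State n := ⟨v.val, v.flag, none, none⟩

open TM2.Stmt in
/-- The program. -/
def program (n : ℕ) : Label → TM2.Stmt (Sym n) Label (State n)
  | .init =>
    pop .A (fun v x => { v with sym := x }) <|
    branch (fun v => v.sym.isNone)
      -- An empty input is the empty pattern. From here on the flag means that some bound equals `n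
      -- + 1`.
      (load (fun v => { v with flag := false }) <| goto fun _ => .drainA) <|
    branch (fun v => decide (v.sym = some .endRow))
      (push .A (fun _ => .endRow) <| load State.clear <| goto fun _ => .flush) <|
    push .B (fun v => v.sym.getD .noArc) <| push .C (fun _ => 0) <| push .R (fun _ => 0) <|
    load State.clear <| goto fun _ => .init
  | .flush =>
    pop .B (fun v x => { v with sym := x }) <|
    branch (fun v => v.sym.isNone)
      (branch (fun v => v.flag)
        (load (fun v => { v with flag := false }) <| goto fun _ => .head)
        (goto fun _ => .drainA)) <|
    push .A (fun v => v.sym.getD .noArc) <| load State.clear <| goto fun _ => .flush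
  | .head =>
    pop .R (fun v x => { v with bound := x }) <|
    branch (fun v => v.bound.isNone) (goto fun _ => .rev) <|
    load (fun v => State.clear { v with val := v.bound.getD 0 }) <| goto fun _ => .cells
  | .cells =>
    pop .A (fun v x => { v with sym := x }) <|
    branch (fun v => decide (v.sym = some .endRow))
      (push .B (fun _ => .endRow) <| push .R' (fun v => v.val) <|
        load (fun v => State.clear { v with val := 0 }) <| goto fun _ => .back) <|
    pop .C (fun v x => { v with bound := x }) <|
    -- The defaults in `getD` are never used on valid input: a marker ends each row, and `C` holds
    -- one bound per entry.
    push .C' (fun v => col (v.sym.getD .noArc) v.val (v.bound.getD 0)) <|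
    push .B (fun v => v.sym.getD .noArc) <|
    load (fun v =>
      ⟨(cell (v.sym.getD .noArc) (v.val, v.flag) (v.bound.getD 0)).1,
        (cell (v.sym.getD .noArc) (v.val, v.flag) (v.bound.getD 0)).2, none, none⟩) <|
    goto fun _ => .cells
  | .back =>
    pop .C' (fun v x => { v with bound := x }) <|
    branch (fun v => v.bound.isNone) (goto fun _ => .head) <|
    push .C (fun v => v.bound.getD 0) <| load State.clear <| goto fun _ => .back
  | .rev =>
    pop .C (fun v x => { v with bound := x }) <|
    branch (fun v => v.bound.isNone) (goto fun _ => .merge) <|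
    push .C' (fun v => v.bound.getD 0) <| load State.clear <| goto fun _ => .rev
  | .merge =>
    pop .C' (fun v x => { v with bound := x }) <|
    branch (fun v => v.bound.isNone) (goto fun _ => .flush) <|
    pop .R' (fun v x => { v with val := x.getD 0 }) <|
    push .C (fun v => max v.val (v.bound.getD 0)) <|
    push .R (fun v => max v.val (v.bound.getD 0)) <|
    load (fun v => State.clear { v with val := 0 }) <| goto fun _ => .merge
  | .drainA =>
    pop .A (fun v x => { v with sym := x }) <|
    branch (fun v => v.sym.isNone) (goto fun _ => .drainC) <|
    load State.clear <| goto fun _ => .drainA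
  | .drainC =>
    pop .C (fun v x => { v with bound := x }) <|
    pop .R (fun v _ => v) <|
    branch (fun v => v.bound.isNone)
      -- A halting configuration must have the initial internal state and empty stacks apart from
      -- the output; hence the draining and this reset.
      (push .O (fun v => !v.flag) <| load (fun _ => ⟨0, true, none, none⟩) halt) <|
    load (fun v => State.clear { v with flag := v.flag || decide (v.bound = some (Fin.last _)) }) <|
    goto fun _ => .drainC

/-- The bundled machine. -/
def machine (n : ℕ) : FinTM2 where
  K := Stack
  k₀ := .A
  k₁ := .O
  Γ := Sym n
  Λ := Label
  main := .init
  σ := State n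
  initialState := ⟨0, true, none, none⟩
  Γk₀Fin := inferInstanceAs (Fintype ArcSymbol)
  m := program n

/-- The contents of the stacks. -/
def contents (A B : List ArcSymbol) (C C' R R' : List (Fin (n + 2))) (O : List Bool) :
    ∀ k, List (Sym n k)
  | .A => A
  | .B => B
  | .C => C
  | .C' => C'
  | .R => R
  | .R' => R'
  | .O => O

/-- A configuration between two instructions. -/
def cfg (l : Label) (v : Fin (n + 2)) (b : Bool) (A B : List ArcSymbol)
    (C C' R R' : List (Fin (n + 2))) : TM2.Cfg (Sym n) Label (State n) :=
  ⟨some l, ⟨v, b, none, none⟩, contents A B C C' R R' []⟩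

section update

variable (A B : List ArcSymbol) (C C' R R' : List (Fin (n + 2))) (O : List Bool)

theorem update_A (x : List ArcSymbol) :
    Function.update (contents A B C C' R R' O) .A x = contents x B C C' R R' O := by
  funext k; cases k <;> rfl

theorem update_B (x : List ArcSymbol) :
    Function.update (contents A B C C' R R' O) .B x = contents A x C C' R R' O := by
  funext k; cases k <;> rfl

theorem update_C (x : List (Fin (n + 2))) :
    Function.update (contents A B C C' R R' O) .C x = contents A B x C' R R' O := by
  funext k; cases k <;> rfl

theorem update_C' (x : List (Fin (n + 2))) :
    Function.update (contents A B C C' R R' O) .C' x = contents A B C x R R' O := by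
  funext k; cases k <;> rfl

theorem update_R (x : List (Fin (n + 2))) :
    Function.update (contents A B C C' R R' O) .R x = contents A B C C' x R' O := by
  funext k; cases k <;> rfl

theorem update_R' (x : List (Fin (n + 2))) :
    Function.update (contents A B C C' R R' O) .R' x = contents A B C C' R x O := by
  funext k; cases k <;> rfl

theorem update_O (x : List Bool) :
    Function.update (contents A B C C' R R' O) .O x = contents A B C C' R R' x := by
  funext k; cases k <;> rfl

end update

/-! ### Running times of the phases -/

/-- At most `k` steps of the machine. -/
abbrev Run (k : ℕ) (c d : TM2.Cfg (Sym n) Label (State n)) : Prop :=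
  ReachesWithin (TM2.step (program n)) k c d

variable {v : Fin (n + 2)} {b : Bool} {A B : List ArcSymbol} {C C' R R' : List (Fin (n + 2))}

/-- The first row has one entry per vertex, so scanning it sets up a zero bound for each vertex on
both `C` and `R`. -/
theorem run_init (l : List ArcSymbol) (hl : ArcSymbol.endRow ∉ l) :
    Run (l.length + 1) (cfg .init v b (l ++ .endRow :: A) B C C' R R')
      (cfg .flush v b (.endRow :: A) (l.reverse ++ B) (List.replicate l.length 0 ++ C) C'
        (List.replicate l.length 0 ++ R) R') := by
  induction l generalizing B C R with
  | nil =>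
    refine .single ?_
    simp [cfg, program, contents, update_A, State.clear]
  | cons s l ih =>
    simp only [List.mem_cons, not_or] at hl
    refine .head ?_ (by
      simpa [List.replicate_succ', List.append_assoc] using
        ih (B := s :: B) (C := 0 :: C) (R := 0 :: R) hl.2)
    simp [cfg, program, contents, update_A, update_B, update_C, update_R, State.clear,
      Ne.symm hl.1]

theorem run_flush : Run (B.length + 1) (cfg .flush v b A B C C' R R')
    (cfg (cond b .head .drainA) v false (B.reverse ++ A) [] C C' R R') := by
  induction B generalizing A with
  | nil =>
    refine .single ?_
    cases b <;> simp [cfg, program, contents, update_B, State.clear]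
  | cons s B ih =>
    refine .head ?_ (by simpa using ih (A := s :: A))
    simp [cfg, program, contents, update_A, update_B, State.clear]

theorem run_cells (l : List ArcSymbol) (hl : ArcSymbol.endRow ∉ l) (hC : l.length = C.length) :
    Run (l.length + 1) (cfg .cells v b (l ++ .endRow :: A) B C C' R R')
      (cfg .back 0 (line (v, b) l C).1.2 A (.endRow :: l.reverse ++ B) []
        ((line (v, b) l C).2.reverse ++ C') R ((line (v, b) l C).1.1 :: R')) := by
  induction l generalizing v b B C C' with
  | nil =>
    obtain rfl := List.length_eq_zero_iff.1 hC.symm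
    refine .single ?_
    simp [cfg, program, contents, update_A, update_B, update_R', State.clear, line]
  | cons s l ih =>
    obtain _ | ⟨c, C⟩ := C
    · simp at hC
    simp only [List.mem_cons, not_or] at hl
    refine .head ?_ (by
      simpa [line] using ih (v := (cell s (v, b) c).1) (b := (cell s (v, b) c).2) (B := s :: B)
        (C := C) (C' := col s v c :: C') hl.2 (by simpa using hC))
    simp [cfg, program, contents, update_A, update_B, update_C, update_C', Ne.symm hl.1]

theorem run_back : Run (C'.length + 1) (cfg .back v b A B C C' R R')
    (cfg .head v b A B (C'.reverse ++ C) [] R R') := by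
  induction C' generalizing C with
  | nil =>
    refine .single ?_
    simp [cfg, program, contents, update_C']
  | cons c C' ih =>
    refine .head ?_ (by simpa using ih (C := c :: C))
    simp [cfg, program, contents, update_C, update_C', State.clear]

theorem run_rev : Run (C.length + 1) (cfg .rev v b A B C C' R R')
    (cfg .merge v b A B [] (C.reverse ++ C') R R') := by
  induction C generalizing C' with
  | nil =>
    refine .single ?_
    simp [cfg, program, contents, update_C]
  | cons c C ih =>
    refine .head ?_ (by simpa using ih (C' := c :: C'))
    simp [cfg, program, contents, update_C, update_C', State.clear]

/-- After a sweep `R'` has the last vertex on top, and the phase `rev` brings `C'` into the same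
order. Merging from the top restores the original order on `C` and `R`. -/
theorem run_merge (h : R'.length = C'.length) : Run (C'.length + 1) (cfg .merge 0 b A B C C' R R')
    (cfg .flush 0 b A B ((List.zipWith max R' C').reverse ++ C) []
      ((List.zipWith max R' C').reverse ++ R) []) := by
  induction C' generalizing C R R' with
  | nil =>
    obtain rfl := List.length_eq_zero_iff.1 h
    refine .single ?_
    simp [cfg, program, contents, update_C']
  | cons c C' ih =>
    obtain _ | ⟨r, R'⟩ := R'
    · simp at h
    refine .head ?_ (by
      simpa using ih (C := max r c :: C) (R := max r c :: R) (R' := R') (by simpa using h))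
    simp [cfg, program, contents, update_C, update_C', update_R, update_R', State.clear]

theorem run_drainA : Run (A.length + 1) (cfg .drainA v b A B C C' R R')
    (cfg .drainC v b [] B C C' R R') := by
  induction A with
  | nil =>
    refine .single ?_
    simp [cfg, program, contents, update_A]
  | cons s A ih =>
    refine .head ?_ ih
    simp [cfg, program, contents, update_A, State.clear]

theorem run_drainC (h : R.length = C.length) : Run (C.length + 1) (cfg .drainC v b A B C C' R R')
    ⟨none, ⟨0, true, none, none⟩,
      contents A B [] C' [] R' [!(b || C.any (fun c => decide (c = Fin.last _)))]⟩ := by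
  induction C generalizing R b with
  | nil =>
    obtain rfl := List.length_eq_zero_iff.1 h
    refine .single ?_
    simp [cfg, program, contents, update_C, update_R, update_O]
  | cons c C ih =>
    obtain _ | ⟨r, R⟩ := R
    · simp at h
    refine .head ?_ (by
      simpa [Bool.or_assoc] using
        ih (R := R) (b := b || decide (c = Fin.last _)) (by simpa using h))
    simp [cfg, program, contents, update_C, update_R, State.clear]

/-- The encoding of a matrix. -/
def flat (ls : List (List ArcSymbol)) : List ArcSymbol :=
  (ls.map (· ++ [ArcSymbol.endRow])).flatten

@[simp] theorem flat_nil : flat [] = [] := rfl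

@[simp] theorem flat_cons (l : List ArcSymbol) (ls : List (List ArcSymbol)) :
    flat (l :: ls) = l ++ .endRow :: flat ls := by simp [flat]

theorem length_flat {m : ℕ} {ls : List (List ArcSymbol)} (h : ∀ l ∈ ls, l.length = m) :
    (flat ls).length = ls.length * (m + 1) := by
  induction ls with
  | nil => simp
  | cons l ls ih =>
    simp [ih fun l' h' => h l' (by simp [h']), h l (by simp)]
    ring

/-- With `m` columns, a row costs one step to fetch its bound, `m + 1` for the cells and `m + 1` to
restore the column bounds. The last step finds `R` empty. -/
theorem run_matrix (ls : List (List ArcSymbol)) (hend : ∀ l ∈ ls, ArcSymbol.endRow ∉ l)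
    (hR : ls.length = R.length) (hC : ∀ l ∈ ls, l.length = C.length) :
    Run (R.length * (2 * C.length + 3) + 1) (cfg .head 0 b (flat ls) B C [] R R')
      (cfg .rev 0 (matrix b ls R C).2.2 [] ((flat ls).reverse ++ B) (matrix b ls R C).2.1 [] []
        ((matrix b ls R C).1.reverse ++ R')) := by
  induction ls generalizing b B C R R' with
  | nil =>
    obtain rfl := List.length_eq_zero_iff.1 hR.symm
    refine (ReachesWithin.single ?_).mono (by omega)
    simp [cfg, program, contents, update_R, matrix]
  | cons l ls ih =>
    obtain _ | ⟨r, R⟩ := R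
    · simp at hR
    have hl := hC l (by simp)
    have hlen := length_line (r, b) l C hl
    have h1 : Run 1 (cfg .head 0 b (flat (l :: ls)) B C [] (r :: R) R')
        (cfg .cells r b (l ++ .endRow :: flat ls) B C [] R R') := by
      refine .single ?_
      simp [cfg, program, contents, update_R, State.clear]
    have h2 := run_cells (v := r) (b := b) (A := flat ls) (B := B) (C' := []) (R := R) (R' := R')
      l (hend l (by simp)) hl
    have h3 := run_back (v := 0) (b := (line (r, b) l C).1.2) (A := flat ls)
      (B := .endRow :: l.reverse ++ B) (C := []) (C' := (line (r, b) l C).2.reverse ++ [])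
      (R := R) (R' := (line (r, b) l C).1.1 :: R')
    have h4 := ih (b := (line (r, b) l C).1.2) (B := .endRow :: l.reverse ++ B)
      (C := (line (r, b) l C).2) (R := R) (R' := (line (r, b) l C).1.1 :: R')
      (fun l' h' => hend l' (by simp [h'])) (by simpa using hR)
      (fun l' h' => by rw [hlen]; exact hC l' (by simp [h']))
    have h := ((h1.trans h2).trans h3).trans (by simpa using h4)
    refine (by simpa [matrix] using h : Run _ _ _).mono ?_
    simp only [List.length_cons, hlen, hl]
    ring_nf
    rfl

theorem run_round {ls : List (List ArcSymbol)} {g : List (Fin (n + 2))}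
    (hend : ∀ l ∈ ls, ArcSymbol.endRow ∉ l) (hg : ls.length = g.length)
    (hl : ∀ l ∈ ls, l.length = g.length) :
    Run (3 * g.length * g.length + 6 * g.length + 4) (cfg .head 0 false (flat ls) [] g [] g [])
      (cfg (cond (changes ls g) .head .drainA) 0 false (flat ls) [] (round ls g) []
        (round ls g) []) := by
  have hlen := length_matrix false ls g g hg hl
  have h1 := run_matrix (b := false) (B := []) (R' := []) ls hend hg hl
  have h2 := run_rev (v := 0) (b := (matrix false ls g g).2.2) (A := [])
    (B := (flat ls).reverse ++ []) (C := (matrix false ls g g).2.1) (C' := []) (R := [])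
    (R' := (matrix false ls g g).1.reverse ++ [])
  have h3 := run_merge (b := (matrix false ls g g).2.2) (A := [])
    (B := (flat ls).reverse ++ []) (C := []) (C' := (matrix false ls g g).2.1.reverse ++ [])
    (R := []) (R' := (matrix false ls g g).1.reverse ++ []) (by simp [hlen])
  have h4 := run_flush (v := 0) (b := (matrix false ls g g).2.2) (A := [])
    (B := (flat ls).reverse ++ []) (C := round ls g) (C' := []) (R := round ls g) (R' := [])
  have hround : (List.zipWith max ((matrix false ls g g).1.reverse ++ [])
      ((matrix false ls g g).2.1.reverse ++ [])).reverse ++ [] = round ls g := by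
    simp only [List.append_nil]
    rw [← List.reverse_zipWith (hlen.1.trans hlen.2.symm), List.reverse_reverse, round]
  rw [hround] at h3
  have h := ((h1.trans h2).trans h3).trans h4
  simp only [List.append_nil, List.reverse_reverse] at h
  refine h.mono ?_
  simp only [List.length_reverse, hlen, length_flat hl, hg]
  ring_nf
  rfl

/-! ### Termination and correctness -/

/-- Relaxation until nothing changes, by induction on the room left for the bounds to grow. -/
theorem run_loop {ls : List (List ArcSymbol)} (hend : ∀ l ∈ ls, ArcSymbol.endRow ∉ l)
    (d : ℕ) : ∀ g : List (Fin (n + 2)), ls.length = g.length →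
    (∀ l ∈ ls, l.length = g.length) → g.length * (n + 1) ≤ weight g + d →
    ∃ g' : List (Fin (n + 2)), g'.length = g.length ∧
      Run ((d + 1) * (3 * g.length * g.length + 6 * g.length + 4))
        (cfg .head 0 false (flat ls) [] g [] g [])
        (cfg .drainA 0 false (flat ls) [] g' [] g' []) ∧
      ((∀ c ∈ g', (c : ℕ) ≤ n) → MatrixAdmits ls (g'.map Fin.val) (g'.map Fin.val)) ∧
      ∀ xs, Below g xs → MatrixAdmits ls xs xs → Below g' xs := by
  induction d with
  | zero =>
    intro g hg hl hd
    have h := run_round hend hg hl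
    rcases hc : changes ls g with _ | _
    · rw [hc, (round_fixed hg hl hc).1] at h
      exact ⟨g, rfl, h.mono (by omega), (round_fixed hg hl hc).2, fun _ h _ => h⟩
    -- No room is left, so a change would push the sum above its maximum.
    · have h1 := weight_lt_round hg hl hc
      have h2 := weight_le (round ls g)
      rw [length_round hg hl] at h2
      omega
  | succ d ih =>
    intro g hg hl hd
    have h := run_round hend hg hl
    rcases hc : changes ls g with _ | _
    · rw [hc, (round_fixed hg hl hc).1] at h
      exact ⟨g, rfl, h.mono (Nat.le_mul_of_pos_left _ (by omega)), (round_fixed hg hl hc).2,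
        fun _ h _ => h⟩
    · have h1 := weight_lt_round hg hl hc
      have hlen := length_round hg hl
      rw [hc] at h
      obtain ⟨g', h2, h3, h4, h5⟩ := ih (round ls g) (by rw [hlen, hg])
        (by rw [hlen]; exact hl) (by rw [hlen]; omega)
      rw [hlen] at h2 h3
      refine ⟨g', h2, (h.trans h3).mono (by ring_nf; rfl), h4, fun xs hx hadm => ?_⟩
      exact h5 xs (round_below hx hadm) hadm

theorem below_replicate_zero (xs : List ℕ) :
    Below (List.replicate xs.length (0 : Fin (n + 2))) xs := by
  induction xs with
  | nil => exact .nil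
  | cons x xs ih => exact .cons (by simp) ih

theorem Below.le_of_mem {g : List (Fin (n + 2))} {xs : List ℕ} (h : Below g xs)
    (hxs : ∀ x ∈ xs, x ≤ n) : ∀ c ∈ g, (c : ℕ) ≤ n := by
  induction h with
  | nil => simp
  | cons h _ ih =>
    simp only [List.mem_cons, forall_eq_or_imp] at hxs ⊢
    exact ⟨h.trans hxs.1, ih hxs.2⟩

/-- The bounds lie below every solution, and they form one themselves if none of them is `n + 1`.
The expression `false || _` is the form in which `run_drainC` leaves the answer. -/
theorem exists_admits_iff {ls : List (List ArcSymbol)} {g : List (Fin (n + 2))}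
    (hfix : (∀ c ∈ g, (c : ℕ) ≤ n) → MatrixAdmits ls (g.map Fin.val) (g.map Fin.val))
    (hbelow : ∀ xs, MatrixAdmits ls xs xs → Below g xs) :
    (∃ xs : List ℕ, (∀ x ∈ xs, x ≤ n) ∧ MatrixAdmits ls xs xs) ↔
      (!(false || g.any fun c => decide (c = Fin.last _))) = true := by
  have h : (!(false || g.any fun c => decide (c = Fin.last _))) = true ↔
      ∀ c ∈ g, (c : ℕ) ≤ n := by
    simp only [Bool.false_or, Bool.not_eq_true', List.any_eq_false, decide_eq_true_eq,
      Fin.ext_iff, Fin.val_last]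
    refine forall₂_congr fun c _ => ?_
    omega
  rw [h]
  constructor
  · rintro ⟨xs, hxs, hadm⟩
    exact Below.le_of_mem (hbelow xs hadm) hxs
  · intro hg
    exact ⟨g.map Fin.val, by simpa using hg, hfix hg⟩

/-- The machine decides whether a matrix is admitted by positions on a path with `n` arcs. -/
theorem run_machine (m : ℕ) (ls : List (List ArcSymbol))
    (hend : ∀ l ∈ ls, ArcSymbol.endRow ∉ l) (hm : ls.length = m) (hl : ∀ l ∈ ls, l.length = m) :
    ∃ b : Bool, (b = true ↔ ∃ xs : List ℕ, (∀ x ∈ xs, x ≤ n) ∧ MatrixAdmits ls xs xs) ∧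
      Run (n := n) (10 * (n + 2) * (m * (m + 1) + 1) ^ 2) (cfg .init 0 true (flat ls) [] [] [] [] [])
        ⟨none, ⟨0, true, none, none⟩, contents [] [] [] [] [] [] [b]⟩ := by
  obtain _ | ⟨l, ls⟩ := ls
  · refine ⟨true, by simpa using ⟨[], by simp, .nil⟩, ?_⟩
    have h1 : Run 1 (cfg (n := n) .init 0 true (flat []) [] [] [] [] [])
        (cfg .drainA 0 false [] [] [] [] [] []) := by
      refine .single ?_
      simp [cfg, program, contents, update_A]
    have h := (h1.trans run_drainA).trans (run_drainC rfl)
    refine h.mono ?_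
    simp at hm
    subst hm
    simp
    omega
  · have hlm := hl l (by simp)
    have h1 := run_init (n := n) (v := 0) (b := true) (A := flat ls) (B := []) (C := [])
      (C' := []) (R := []) (R' := []) l (hend l (by simp))
    have h2 := run_flush (v := 0) (b := true) (A := .endRow :: flat ls) (B := l.reverse ++ [])
      (C := List.replicate l.length (0 : Fin (n + 2)) ++ []) (C' := [])
      (R := List.replicate l.length 0 ++ []) (R' := [])
    -- All bounds are zero at the start, so the room to grow is the full `m * (n + 1)`.
    obtain ⟨g, hg, h3, hfix, hbelow⟩ := run_loop hend (m * (n + 1))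
      (List.replicate m (0 : Fin (n + 2))) (by simpa using hm) (by simpa using hl) (by simp)
    have h4 := run_drainA (v := 0) (b := false) (A := flat (l :: ls)) (B := []) (C := g)
      (C' := []) (R := g) (R' := [])
    have h5 := run_drainC (v := 0) (b := false) (A := []) (B := []) (C := g) (C' := [])
      (R := g) (R' := []) rfl
    refine ⟨_, (exists_admits_iff hfix fun xs hadm => hbelow xs ?_ hadm).symm, ?_⟩
    · rw [← hm, List.Forall₂.length_eq hadm]
      exact below_replicate_zero xs
    · simp only [List.append_nil, List.reverse_reverse, cond_true, hlm] at h1 h2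
      rw [flat_cons] at h3 h4 ⊢
      have h := (((h1.trans h2).trans h3).trans h4).trans h5
      refine h.mono ?_
      rw [← flat_cons, length_flat hl, hm, hg]
      simp only [List.length_replicate, List.length_reverse, hlm]
      -- With `N = m * (m + 1) + 1`, the loop costs at most `6 * (n + 2) * N ^ 2`, and each of the
      -- four other phases at most `N`, hence the constant `10`.
      have e1 : m * (n + 1) + 1 ≤ (n + 2) * (m * (m + 1) + 1) := by
        have : m ≤ m * (m + 1) + 1 := by nlinarith
        calc m * (n + 1) + 1 ≤ (m * (m + 1) + 1) * (n + 1) + (m * (m + 1) + 1) :=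
              Nat.add_le_add (Nat.mul_le_mul_right _ this) (by omega)
          _ = (n + 2) * (m * (m + 1) + 1) := by ring
      have e2 : 3 * m * m + 6 * m + 4 ≤ 6 * (m * (m + 1) + 1) := by nlinarith
      have e3 := Nat.mul_le_mul e1 e2
      have e4 : m + 1 ≤ m * (m + 1) + 1 := by nlinarith
      have e5 : 1 * (m * (m + 1) + 1) ≤ (n + 2) * (m * (m + 1) + 1) ^ 2 := by
        rw [pow_two]
        exact Nat.mul_le_mul (by omega) (Nat.le_mul_of_pos_left _ (by omega))
      have e6 : (n + 2) * (m * (m + 1) + 1) * (6 * (m * (m + 1) + 1)) =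
          6 * ((n + 2) * (m * (m + 1) + 1) ^ 2) := by ring
      rw [Nat.mul_assoc 10]
      omega

end Relax.Machine

/-! ### The polynomial-time decision procedure -/

theorem mainTheorem10 {α : Type} (a : α) {V : Type*} (Q : RGP α V)
    (hpath : IsDirectedPath Q.digraph)
    (hlabel : ∀ (x y : V) (E : RegularExpression α), Q.label x y = some E →
      E = RegularExpression.char a) :
    SolvableInPolyTime (APlusInstance.encode (a := a))
      (fun P => P.pattern.HasNHom Q) := by
  obtain ⟨n, q, hq⟩ := hpath
  choose f hf hrun using fun P : APlusInstance a => Relax.Machine.run_machine (n := n) P.m P.rows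
    P.endRow_notMem_of_mem_rows P.length_rows P.length_of_mem_rows
  refine ⟨f, fun P => (hf P).trans (P.hasNHom_iff hq hlabel).symm,
    { tm := Relax.Machine.machine n
      inputAlphabet := Equiv.refl ArcSymbol
      outputAlphabet := Equiv.refl Bool
      time := 10 * (Polynomial.C n + 2) * (Polynomial.X + 1) ^ 2
      outputsFun := fun P => ?_ }, ?_⟩
  · have hinit : Turing.initList (Relax.Machine.machine n)
        (P.encode.map (Equiv.refl ArcSymbol).invFun) =
          Relax.Machine.cfg .init 0 true (Relax.Machine.flat P.rows) [] [] [] [] [] := by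
      rw [Relax.Machine.flat, ← P.encode_eq]
      refine congrArg (Turing.TM2.Cfg.mk _ _) (funext fun k => ?_)
      cases k <;> first | rfl | exact List.map_id _
    have hhalt : Turing.haltList (Relax.Machine.machine n)
        ((Computability.encodeBool (f P)).map (Equiv.refl Bool).invFun) =
          ⟨none, ⟨0, true, none, none⟩,
            Relax.Machine.contents [] [] [] [] [] [] [f P]⟩ := by
      refine congrArg (Turing.TM2.Cfg.mk _ _) (funext fun k => ?_)
      cases k <;> rfl
    refine
      { steps := (hrun P).choose
        evals_in_steps := ?_
        steps_le_m := (hrun P).choose_spec.1.trans ?_ }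
    · rw [hinit, Option.map_some, hhalt]
      exact (hrun P).choose_spec.2
    · simp [APlusInstance.length_encode]
  · rintro (_ | _ | _ | _ | _ | _ | _)
    exacts [inferInstanceAs (Finite ArcSymbol), inferInstanceAs (Finite ArcSymbol),
      inferInstanceAs (Finite (Fin (n + 2))), inferInstanceAs (Finite (Fin (n + 2))),
      inferInstanceAs (Finite (Fin (n + 2))), inferInstanceAs (Finite (Fin (n + 2))),
      inferInstanceAs (Finite Bool)]
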